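/- Let $G$ be a second-countable, locally compact (Hausdorff), non-compact group with a left Haar measure $\mu$; let $S\subset G$, $1\le p<\infty$, and let $\Gamma\subset\mathbb{C}$ be such that $\Gamma\setminus\{0\}\neq\emptyset$. Let $\omega:G\to(0,\infty)$ be a locally $p$-integrable weight that is $S$-admissible, i.e. $\operatorname{ess\,sup}_{t\in G}\omega(st)/\omega(t)<\infty$ for every $s\in S$. Let $L^p(G,\omega)$ be the space of (classes of) measurable functions $f:G\to\mathbb{C}$ with $\|f\|_{p,\omega}=\big(\int_G|f|^p\omega^p\,d\mu\big)^{1/p}<\infty$, and let $(T_sf)(t)=f(s^{-1}t)$. A vector $f\in L^p(G,\omega)$ is called $(\Gamma,S)$-dense if $\{\lambda T_sf:\lambda\in\Gamma,\ s\in S\}$ is dense in $L^p(G,\omega)$. (i) Suppose that for every compact $K\subset G$ and all $\varepsilon,\delta>0$ there exist $s\in S$, $\lambda\in\Gamma\setminus\{0\}$ and a compact $E\subset K$ such that $\mu(K\setminus E)<\delta$, $$|\lambda|\operatorname*{ess\,sup}_{sE}\omega<\varepsilon\quad\text{and}\quad \frac1{|\lambda|}\operatorname*{ess\,sup}_{s^{-1}E}\omega<\varepsilon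 .$$ Then $L^p(G,\omega)$ has a $(\Gamma,S)$-dense vector. (ii) Consequently, suppose that for every compact $K\subset G$ there exists $\lambda\in\Gamma\setminus\{0\}$ such that $$\inf_{s\in S}\max\Big\{|\lambda|\operatorname*{ess\,sup}_{sK}\omega\,;\ \frac1{|\lambda|}\operatorname*{ess\,sup}_{s^{-1}K}\omega\Big\}=0 .$$ Then $L^p(G,\omega)$ has a $(\Gamma,S)$-dense vector. Here the essential supremum of $\omega$ over a null set is $0$ and an infimum over the empty set is $+\infty$. -/

import Mathlib

open MeasureTheory Set
open scoped ENNReal Pointwise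

/-- The measure `ω ^ p dμ`, so that `∫ |f| ^ p d(ω ^ p μ) = ∫ |f| ^ p ω ^ p dμ`. -/
noncomputable def weightedMeasure {G : Type*} [MeasurableSpace G] (μ : Measure G)
    (p : ℝ≥0∞) (ω : G → ℝ) : Measure G :=
  μ.withDensity fun t => ENNReal.ofReal (ω t) ^ p.toReal

/-- The weighted space `L^p(G, ω)` (complex-valued), with norm
`(∫ |f t| ^ p * ω t ^ p dμ) ^ (1 / p)`. -/
noncomputable abbrev WeightedLp {G : Type*} [MeasurableSpace G] (μ : Measure G)
    (p : ℝ≥0∞) (ω : G → ℝ) : Type _ :=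
  Lp ℂ p (weightedMeasure μ p ω)

/-- The essential supremum of a positive function `ω` over a set `A`, as an element of `[0, ∞]`. -/
noncomputable def essSupOn {G : Type*} [MeasurableSpace G] (μ : Measure G) (ω : G → ℝ)
    (A : Set G) : ℝ≥0∞ :=
  essSup (fun t => ENNReal.ofReal (ω t)) (μ.restrict A)

/-- `M(s)`, the essential supremum of `ω (s t) / ω t` over `t ∈ G`, as an element of `[0, ∞]`. -/
noncomputable def translationBound {G : Type*} [Mul G] [MeasurableSpace G] (μ : Measure G)
    (ω : G → ℝ) (s : G) : ℝ≥0∞ :=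
  essSup (fun t => ENNReal.ofReal (ω (s * t) / ω t)) μ

/-- The conditions on `S`, `p`, `ω`, `Γ` in the notion of an admissible tuple. Those on the group
(locally compact, second countable, not compact) and `1 ≤ p` are expressed by type classes.
Measurability of `ω` up to a null set is part of the local integrability of `ω ^ p`. -/
structure IsAdmissibleTuple {G : Type*} [Group G] [TopologicalSpace G] [IsTopologicalGroup G]
    [T2Space G] [LocallyCompactSpace G] [SecondCountableTopology G] [NoncompactSpace G]
    [MeasurableSpace G] [BorelSpace G] (μ : Measure G) [μ.IsHaarMeasure]
    (S : Set G) (p : ℝ≥0∞) [Fact (1 ≤ p)] (ω : G → ℝ) (Γ : Set ℂ) : Prop where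
  exponent_ne_top : p ≠ ∞
  scalars_nonempty : (Γ \ {0}).Nonempty
  weight_pos : ∀ t, 0 < ω t
  weight_locallyIntegrable : LocallyIntegrable (fun t => ω t ^ p.toReal) μ
  translationBound_lt_top : ∀ s ∈ S, translationBound μ ω s < ∞

/-- The orbit `{c • T_s f : c ∈ Γ, s ∈ S}`, where `(T_s f) t = f (s⁻¹ t)`; elements of the weighted
space are functions up to equality almost everywhere. -/
def translationOrbit {G : Type*} [Group G] [MeasurableSpace G] {μ : Measure G}
    {p : ℝ≥0∞} {ω : G → ℝ} (Γ : Set ℂ) (S : Set G) (f : WeightedLp μ p ω) :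
    Set (WeightedLp μ p ω) :=
  {h | ∃ c ∈ Γ, ∃ s ∈ S, ∀ᵐ t ∂μ, h t = c * f (s⁻¹ * t)}

/-- `f` is a `(Γ, S)`-dense vector of `L^p(G, ω)`. -/
def IsDenseVector {G : Type*} [Group G] [MeasurableSpace G] {μ : Measure G}
    {p : ℝ≥0∞} [Fact (1 ≤ p)] {ω : G → ℝ} (Γ : Set ℂ) (S : Set G) (f : WeightedLp μ p ω) : Prop :=
  Dense (translationOrbit Γ S f)

/-! By Baire category, it suffices that the maps `c • T_s`, with `s ∈ S` and `c ∈ Γ \ {0}`, move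
some point of any nonempty open `U` into any nonempty open `V`. Choose compactly supported
continuous `u` near a point of `U` and `v` near a point of `V`, let `K` contain both supports, and
put `x = 1_E u + c⁻¹ T_{s⁻¹}(1_E v)`. Then `x - u` and `c T_s x - v` each consist of a remainder on
`K \ E` and one translated term. The remainder is small by absolute continuity of `ω ^ p μ` on `K`;
the translated term is small by the weight condition, since `μ (s^{±1} E) = μ E ≤ μ K`. This is
`exists_Lp_approx_of_essSupOn_small`. Part (ii) is the case `E = K`. -/

/-- **Birkhoff transitivity theorem** for a family of continuous maps. -/
theorem exists_dense_range_of_transitive {X ι : Type*} [TopologicalSpace X] [BaireSpace X]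
    [SecondCountableTopology X] [Nonempty X] (T : ι → X → X) (hT : ∀ i, Continuous (T i))
    (h : ∀ U V : Set X, IsOpen U → IsOpen V → U.Nonempty → V.Nonempty →
      ∃ i, (U ∩ T i ⁻¹' V).Nonempty) :
    ∃ x, Dense (range fun i => T i x) := by
  have hdense : Dense (⋂ V ∈ TopologicalSpace.countableBasis X, ⋃ i, T i ⁻¹' V) := by
    refine dense_biInter_of_isOpen (fun V hV => isOpen_iUnion fun i =>
      (TopologicalSpace.isOpen_of_mem_countableBasis hV).preimage (hT i))
      (TopologicalSpace.countable_countableBasis X) fun V hV => ?_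
    refine dense_iff_inter_open.2 fun U hU hUne => ?_
    obtain ⟨i, x, hxU, hxV⟩ := h U V hU (TopologicalSpace.isOpen_of_mem_countableBasis hV) hUne
      (TopologicalSpace.nonempty_of_mem_countableBasis hV)
    exact ⟨x, hxU, mem_iUnion.2 ⟨i, hxV⟩⟩
  obtain ⟨x, hx⟩ := hdense.nonempty
  refine ⟨x, (TopologicalSpace.isBasis_countableBasis X).dense_iff.2 fun V hV _ => ?_⟩
  obtain ⟨i, hi⟩ := mem_iUnion.1 (mem_iInter₂.1 hx V hV)
  exact ⟨T i x, hi, i, rfl⟩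

/-- Composition with a map `τ` is a bounded operator on `L^p(ν)` if the image of `ν` under `τ` is
dominated by a multiple of `ν`. -/
theorem exists_comp_continuousLinearMap {X : Type*} [MeasurableSpace X] {ν : Measure X}
    {p : ℝ≥0∞} [Fact (1 ≤ p)] {τ : X → X} (hτ : Measurable τ) {D : ℝ≥0∞} (hD : D ≠ ∞)
    (hle : ν.map τ ≤ D • ν) :
    ∃ T : Lp ℂ p ν →L[ℂ] Lp ℂ p ν, ∀ f : Lp ℂ p ν, ∀ᵐ t ∂ν, T f t = f (τ t) := by
  have hac : ν.map τ ≪ ν := Measure.absolutelyContinuous_of_le_smul hle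
  have hcomp {f g : X → ℂ} (h : f =ᵐ[ν] g) : f ∘ τ =ᵐ[ν] g ∘ τ :=
    ae_of_ae_map hτ.aemeasurable (hac.ae_le h)
  have hmem (f : Lp ℂ p ν) : MemLp (f ∘ τ) p ν :=
    ((Lp.memLp f).of_measure_le_smul hD hle).comp_of_map hτ.aemeasurable
  let L : Lp ℂ p ν →ₗ[ℂ] Lp ℂ p ν :=
    { toFun := fun f => (hmem f).toLp
      map_add' := fun f g => by
        ext1
        filter_upwards [(hmem (f + g)).coeFn_toLp, (hmem f).coeFn_toLp, (hmem g).coeFn_toLp,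
          Lp.coeFn_add (hmem f).toLp (hmem g).toLp, hcomp (Lp.coeFn_add f g)] with t h1 h2 h3 h4 h5
        simp_all
      map_smul' := fun c f => by
        ext1
        filter_upwards [(hmem (c • f)).coeFn_toLp, (hmem f).coeFn_toLp,
          Lp.coeFn_smul c (hmem f).toLp, hcomp (Lp.coeFn_smul c f)] with t h1 h2 h3 h4
        simp_all }
  refine ⟨L.mkContinuous (D ^ (1 / p).toReal).toReal fun f => ?_,
    fun f => (hmem f).coeFn_toLp⟩
  have h1 : eLpNorm (f ∘ τ) p ν ≤ D ^ (1 / p).toReal * eLpNorm f p ν := by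
    rw [← eLpNorm_map_measure ((Lp.aestronglyMeasurable f).mono_ac hac) hτ.aemeasurable]
    exact eLpNorm_le_of_measure_le_smul hle
  change ‖(hmem f).toLp‖ ≤ _
  rw [Lp.norm_toLp, Lp.norm_def, ← ENNReal.toReal_mul]
  exact ENNReal.toReal_mono (ENNReal.mul_ne_top
    (ENNReal.rpow_ne_top_of_nonneg ENNReal.toReal_nonneg hD) (Lp.eLpNorm_ne_top f)) h1

/-! ### Null sets and norm estimates for the weighted measure. -/

section WeightedMeasure

variable {G : Type*} [MeasurableSpace G] {μ : Measure G} {p : ℝ≥0∞} {ω : G → ℝ}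

theorem ae_weightedMeasure (hω : AEMeasurable ω μ) (hpos : ∀ t, 0 < ω t) :
    ae (weightedMeasure μ p ω) = ae μ := by
  refine le_antisymm (withDensity_absolutelyContinuous _ _).ae_le
    (Measure.AbsolutelyContinuous.ae_le ?_)
  refine withDensity_absolutelyContinuous' (hω.ennreal_ofReal.pow_const _)
    (.of_forall fun t => ?_)
  exact (ENNReal.rpow_pos (ENNReal.ofReal_pos.2 (hpos t)) ENNReal.ofReal_ne_top).ne'

theorem weightedMeasure_le_essSupOn {A : Set G} (hA : MeasurableSet A) :
    weightedMeasure μ p ω A ≤ essSupOn μ ω A ^ p.toReal * μ A := by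
  rw [weightedMeasure, withDensity_apply _ hA, ← setLIntegral_const]
  refine lintegral_mono_ae ?_
  filter_upwards [ENNReal.ae_le_essSup (μ := μ.restrict A) fun t => ENNReal.ofReal (ω t)]
    with t ht
  exact ENNReal.rpow_le_rpow ht ENNReal.toReal_nonneg

theorem eLpNorm_indicator_le_mul_rpow (hp : p ≠ 0) (hp' : p ≠ ∞) {ν : Measure G} {A : Set G}
    (hA : MeasurableSet A) {f : G → ℂ} {C : ℝ} (hf : ∀ t, ‖f t‖ ≤ C) :
    eLpNorm (A.indicator f) p ν ≤ ENNReal.ofReal C * ν A ^ (1 / p.toReal) := by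
  calc eLpNorm (A.indicator f) p ν ≤ eLpNorm (A.indicator fun _ => C) p ν := by
        refine eLpNorm_mono fun t => ?_
        by_cases ht : t ∈ A
        · simpa [ht] using (hf t).trans (le_abs_self C)
        · simp [ht]
    _ = ENNReal.ofReal C * ν A ^ (1 / p.toReal) := by
        -- A point of `G` forces `0 ≤ C`; on an empty space `C` could be negative.
        rcases isEmpty_or_nonempty G with hG | ⟨⟨t⟩⟩
        · simp [Set.eq_empty_of_isEmpty A, ENNReal.toReal_pos hp hp']
        · rw [eLpNorm_indicator_const hA hp hp',
            Real.enorm_of_nonneg ((norm_nonneg _).trans (hf t))]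

theorem eLpNorm_indicator_weightedMeasure_le (hp : p ≠ 0) (hp' : p ≠ ∞) {A : Set G}
    (hA : MeasurableSet A) {f : G → ℂ} {C : ℝ} (hf : ∀ t, ‖f t‖ ≤ C) :
    eLpNorm (A.indicator f) p (weightedMeasure μ p ω) ≤
      ENNReal.ofReal C * (essSupOn μ ω A * μ A ^ (1 / p.toReal)) := by
  refine (eLpNorm_indicator_le_mul_rpow hp hp' hA hf).trans ?_
  gcongr
  have hr : 0 < p.toReal := ENNReal.toReal_pos hp hp'
  calc weightedMeasure μ p ω A ^ (1 / p.toReal)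
      ≤ (essSupOn μ ω A ^ p.toReal * μ A) ^ (1 / p.toReal) := by
        gcongr
        exact weightedMeasure_le_essSupOn hA
    _ = _ := by
        rw [ENNReal.mul_rpow_of_nonneg _ _ (by positivity), ← ENNReal.rpow_mul,
          mul_one_div_cancel hr.ne', ENNReal.rpow_one]

/-- Absolute continuity of the integral of `ω ^ p` over `K`; it controls the discarded part `K \ E`.
-/
theorem exists_weightedMeasure_lt_of_measure_lt {K : Set G} (hK : MeasurableSet K)
    (hfin : weightedMeasure μ p ω K ≠ ∞) {η : ℝ≥0∞} (hη : η ≠ 0) :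
    ∃ δ : ℝ, 0 < δ ∧ ∀ A ⊆ K, MeasurableSet A → μ A < ENNReal.ofReal δ →
      weightedMeasure μ p ω A < η := by
  rw [weightedMeasure, withDensity_apply _ hK] at hfin
  obtain ⟨δ, hδ, h⟩ := exists_pos_setLIntegral_lt_of_measure_lt hfin hη
  obtain ⟨δ', -, h0, hlt⟩ := ENNReal.lt_iff_exists_real_btwn.1 hδ
  refine ⟨δ', ENNReal.ofReal_pos.1 h0, fun A hAK hA hμ => ?_⟩
  have := h A ((Measure.restrict_apply_le _ _).trans_lt (hμ.trans hlt))
  rwa [Measure.restrict_restrict hA, inter_eq_left.2 hAK,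
    ← withDensity_apply _ hA] at this

end WeightedMeasure

/-! ### Boundedness of translations on the weighted space. -/

section Translation

variable {G : Type*} [Group G] [TopologicalSpace G] [IsTopologicalGroup G]
  [MeasurableSpace G] [BorelSpace G] {μ : Measure G}
  {p : ℝ≥0∞} {ω : G → ℝ}

/-- Substituting `t ↦ s * t`, which preserves `μ`, turns the left side at `A` into the integral of
`ω (s t) ^ p` over `A`. -/
theorem map_mul_left_inv_weightedMeasure_le [μ.IsMulLeftInvariant] (hpos : ∀ t, 0 < ω t) {s : G}
    (hs : translationBound μ ω s < ∞) :
    (weightedMeasure μ p ω).map (s⁻¹ * ·) ≤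
      translationBound μ ω s ^ p.toReal • weightedMeasure μ p ω := by
  have hm : Measurable (s⁻¹ * · : G → G) := measurable_const_mul _
  refine Measure.le_iff.2 fun A hA => ?_
  set M := translationBound μ ω s
  have hle : ∀ᵐ t ∂μ, ENNReal.ofReal (ω (s * t)) ^ p.toReal ≤
      M ^ p.toReal * ENNReal.ofReal (ω t) ^ p.toReal := by
    filter_upwards [ENNReal.ae_le_essSup (μ := μ) fun t => ENNReal.ofReal (ω (s * t) / ω t)]
      with t ht
    rw [← ENNReal.mul_rpow_of_nonneg _ _ ENNReal.toReal_nonneg]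
    gcongr
    calc ENNReal.ofReal (ω (s * t)) = ENNReal.ofReal (ω (s * t) / ω t) * ENNReal.ofReal (ω t) := by
          rw [← ENNReal.ofReal_mul (div_pos (hpos _) (hpos _)).le, div_mul_cancel₀ _ (hpos t).ne']
      _ ≤ _ := by gcongr; exact ht
  rw [Measure.map_apply hm hA, Measure.smul_apply, weightedMeasure,
    withDensity_apply _ (hm hA), withDensity_apply _ hA, smul_eq_mul,
    ← lintegral_indicator (hm hA), ← lintegral_mul_left_eq_self _ s, ← lintegral_indicator hA]
  calc _ ≤ ∫⁻ t, M ^ p.toReal * A.indicator (fun t => ENNReal.ofReal (ω t) ^ p.toReal) t ∂μ := by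
        refine lintegral_mono_ae ?_
        filter_upwards [hle] with t ht
        by_cases htA : t ∈ A <;> simp [indicator, htA, ht]
    _ = _ := lintegral_const_mul' _ _ (ENNReal.rpow_ne_top_of_nonneg ENNReal.toReal_nonneg hs.ne)

/-- Left translation by `s` is a bounded operator on the weighted space as soon as
`translationBound μ ω s` is finite. -/
theorem exists_translation_continuousLinearMap [μ.IsMulLeftInvariant] [Fact (1 ≤ p)]
    (hω : AEMeasurable ω μ) (hpos : ∀ t, 0 < ω t) {s : G}
    (hs : translationBound μ ω s < ∞) :
    ∃ T : WeightedLp μ p ω →L[ℂ] WeightedLp μ p ω,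
      ∀ f : WeightedLp μ p ω, ∀ᵐ t ∂μ, T f t = f (s⁻¹ * t) := by
  rw [← ae_weightedMeasure (p := p) hω hpos]
  exact exists_comp_continuousLinearMap (measurable_const_mul _)
    (ENNReal.rpow_ne_top_of_nonneg ENNReal.toReal_nonneg hs.ne)
    (map_mul_left_inv_weightedMeasure_le hpos hs)

end Translation

/-! ### Consequences of local integrability, and density of compactly supported functions. -/

section LocallyIntegrable

variable {G : Type*} [TopologicalSpace G] [MeasurableSpace G] {μ : Measure G} {p : ℝ≥0∞} {ω : G → ℝ}

theorem aemeasurable_of_locallyIntegrable_rpow [SecondCountableTopology G]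
    (hp : p ≠ 0) (hp' : p ≠ ∞) (hpos : ∀ t, 0 < ω t)
    (h : LocallyIntegrable (fun t => ω t ^ p.toReal) μ) : AEMeasurable ω μ := by
  have hr : 0 < p.toReal := ENNReal.toReal_pos hp hp'
  refine (h.aestronglyMeasurable.aemeasurable.pow_const p.toReal⁻¹).congr (.of_forall fun t => ?_)
  exact Real.rpow_rpow_inv (hpos t).le hr.ne'

theorem isLocallyFiniteMeasure_weightedMeasure [OpensMeasurableSpace G] (hpos : ∀ t, 0 < ω t)
    (h : LocallyIntegrable (fun t => ω t ^ p.toReal) μ) :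
    IsLocallyFiniteMeasure (weightedMeasure μ p ω) := by
  refine ⟨fun x => ?_⟩
  obtain ⟨U, hU, hint⟩ := h x
  obtain ⟨V, hVU, hV, hxV⟩ := mem_nhds_iff.1 hU
  refine ⟨V, hV.mem_nhds hxV, ?_⟩
  rw [weightedMeasure, withDensity_apply _ hV.measurableSet]
  refine lt_of_eq_of_lt (lintegral_congr fun t => ?_) (hint.mono_set hVU).lintegral_lt_top
  exact ENNReal.ofReal_rpow_of_pos (hpos t)

end LocallyIntegrable

/-- Compactly supported continuous functions are dense in `L^p`. -/
theorem dense_hasCompactSupport_Lp {X : Type*} [TopologicalSpace X] [T2Space X]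
    [LocallyCompactSpace X] [SecondCountableTopology X] [MeasurableSpace X] [BorelSpace X]
    {p : ℝ≥0∞} {ν : Measure X} [IsLocallyFiniteMeasure ν] [Fact (1 ≤ p)]
    (hp' : p ≠ ∞) :
    Dense {f : Lp ℂ p ν | ∃ u : X → ℂ, Continuous u ∧ HasCompactSupport u ∧ f =ᵐ[ν] u} := by
  refine EMetric.dense_iff.2 fun f r hr => ?_
  obtain ⟨r', hr', hlt⟩ := exists_between hr
  obtain ⟨u, hus, hu, huc, humem⟩ :=
    (Lp.memLp f).exists_hasCompactSupport_eLpNorm_sub_le hp' hr'.ne'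
  refine ⟨humem.toLp, ?_, u, huc, hus, humem.coeFn_toLp⟩
  rw [Metric.mem_eball, edist_comm, Lp.edist_def,
    eLpNorm_congr_ae ((Filter.EventuallyEq.refl _ f).sub humem.coeFn_toLp)]
  exact hu.trans_lt hlt

/-! ### The approximating vector. -/

section Approximation

variable {G : Type*} [Group G] [TopologicalSpace G] [IsTopologicalGroup G]
  [MeasurableSpace G] [BorelSpace G] {μ : Measure G} {p : ℝ≥0∞} {ω : G → ℝ}

/-- Two bounded functions supported in a set `K` can be joined approximately by a multiple of a
translation under which the weight is small on most of `K` in both directions. -/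
theorem exists_Lp_approx_of_essSupOn_small [μ.IsMulLeftInvariant] [Fact (1 ≤ p)] (hp' : p ≠ ∞)
    (hω : AEMeasurable ω μ) (hpos : ∀ t, 0 < ω t) {K E : Set G} (hK : MeasurableSet K)
    (hE : MeasurableSet E) {f g : WeightedLp μ p ω} {u v : G → ℂ} (hu : Continuous u)
    (hv : Continuous v) (hfu : f =ᵐ[μ] u) (hgv : g =ᵐ[μ] v) (huK : ∀ t ∉ K, u t = 0)
    (hvK : ∀ t ∉ K, v t = 0) {C : ℝ} (huC : ∀ t, ‖u t‖ ≤ C) (hvC : ∀ t, ‖v t‖ ≤ C)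
    {s : G} {c : ℂ} (hc : c ≠ 0) {T : WeightedLp μ p ω →L[ℂ] WeightedLp μ p ω}
    (hT : ∀ f : WeightedLp μ p ω, ∀ᵐ t ∂μ, T f t = f (s⁻¹ * t))
    (hEfin : essSupOn μ ω (s⁻¹ • E) ≠ ∞)
    (hEK : E ⊆ K) (hμK : μ K ≠ ∞) :
    ∃ x : WeightedLp μ p ω,
      edist x f ≤ ENNReal.ofReal C * weightedMeasure μ p ω (K \ E) ^ (1 / p.toReal) +
        ENNReal.ofReal C * (ENNReal.ofReal ‖c‖⁻¹ * essSupOn μ ω (s⁻¹ • E) *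
          μ K ^ (1 / p.toReal)) ∧
      edist (c • T x) g ≤ ENNReal.ofReal C * weightedMeasure μ p ω (K \ E) ^ (1 / p.toReal) +
        ENNReal.ofReal C * (ENNReal.ofReal ‖c‖ * essSupOn μ ω (s • E) *
          μ K ^ (1 / p.toReal)) := by
  have hp1 : 1 ≤ p := Fact.out
  have hp0 : p ≠ 0 := (zero_lt_one.trans_le hp1).ne'
  set ν := weightedMeasure μ p ω with hν
  have hae : ae ν = ae μ := ae_weightedMeasure hω hpos
  have hbound (a : G) (b : ℂ) (w : G → ℂ) (hw : ∀ t, ‖w t‖ ≤ C) :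
      eLpNorm ((a • E).indicator fun t => b * w (a⁻¹ * t)) p ν ≤
        ENNReal.ofReal C * (ENNReal.ofReal ‖b‖ * essSupOn μ ω (a • E) * μ K ^ (1 / p.toReal)) := by
    refine (eLpNorm_indicator_weightedMeasure_le (C := ‖b‖ * C) hp0 hp' (hE.const_smul a)
      fun t => ?_).trans ?_
    · rw [norm_mul]
      gcongr
      exact hw _
    · rw [ENNReal.ofReal_mul (norm_nonneg b), measure_smul, mul_comm (ENNReal.ofReal ‖b‖),
        mul_assoc, ← mul_assoc (ENNReal.ofReal ‖b‖)]
      gcongr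
  have hrest (w : G → ℂ) (hw : ∀ t, ‖w t‖ ≤ C) :
      eLpNorm ((K \ E).indicator fun t => -w t) p ν ≤
        ENNReal.ofReal C * ν (K \ E) ^ (1 / p.toReal) :=
    eLpNorm_indicator_le_mul_rpow hp0 hp' (hK.diff hE) fun t => by rw [norm_neg]; exact hw t
  have hmeas (a : G) (b : ℂ) (w : G → ℂ) (hw : Continuous w) :
      AEStronglyMeasurable ((a • E).indicator fun t => b * w (a⁻¹ * t)) ν :=
    (Continuous.aestronglyMeasurable (by fun_prop)).indicator (hE.const_smul a)
  have hmeas' (w : G → ℂ) (hw : Continuous w) :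
      AEStronglyMeasurable ((K \ E).indicator fun t => -w t) ν :=
    (Continuous.aestronglyMeasurable (by fun_prop)).indicator (hK.diff hE)
  -- Since `s⁻¹` need not lie in `S`, translation by it may be unbounded; membership comes from
  -- finiteness of the essential supremum over `s⁻¹ • E`.
  have hmem : MemLp ((s⁻¹ • E).indicator fun t => c⁻¹ * v (s⁻¹⁻¹ * t)) p ν := by
    refine ⟨hmeas _ _ _ hv, (hbound s⁻¹ c⁻¹ v hvC).trans_lt ?_⟩
    exact (ENNReal.mul_ne_top ENNReal.ofReal_ne_top (ENNReal.mul_ne_top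
      (ENNReal.mul_ne_top ENNReal.ofReal_ne_top hEfin)
      (ENNReal.rpow_ne_top_of_nonneg (by positivity) hμK))).lt_top
  have hmem' : MemLp (E.indicator f) p ν := (Lp.memLp f).indicator hE
  obtain ⟨x, hx⟩ : ∃ x : WeightedLp μ p ω, ∀ᵐ t ∂μ, x t = E.indicator u t +
      (s⁻¹ • E).indicator (fun t => c⁻¹ * v (s⁻¹⁻¹ * t)) t := by
    refine ⟨(hmem'.add hmem).toLp, ?_⟩
    filter_upwards [hae ▸ (hmem'.add hmem).coeFn_toLp, hfu] with t h1 h2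
    rw [h1, Pi.add_apply]
    simp [indicator, h2]
  refine ⟨x, ?_, ?_⟩
  · have heq : ⇑x - ⇑f =ᵐ[ν] ((K \ E).indicator fun t => -u t) +
        (s⁻¹ • E).indicator fun t => c⁻¹ * v (s⁻¹⁻¹ * t) := by
      rw [hae]
      filter_upwards [hx, hfu] with t h1 h2
      rw [Pi.sub_apply, Pi.add_apply, h1, h2, add_sub_right_comm]
      congr 1
      by_cases htE : t ∈ E
      · simp [htE]
      · by_cases htK : t ∈ K
        · simp [htE, htK]
        · simp [indicator, htE, htK, huK t htK]
    rw [Lp.edist_def, eLpNorm_congr_ae heq]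
    refine (eLpNorm_add_le (hmeas' u hu) (hmeas _ _ _ hv) hp1).trans (add_le_add (hrest u huC) ?_)
    simpa only [norm_inv] using hbound s⁻¹ c⁻¹ v hvC
  · have heq : ⇑(c • T x) - ⇑g =ᵐ[ν] ((K \ E).indicator fun t => -v t) +
        (s • E).indicator fun t => c * u (s⁻¹ * t) := by
      rw [hae]
      filter_upwards [hT x, hae ▸ Lp.coeFn_smul c (T x), hgv,
        (measurePreserving_mul_left μ s⁻¹).quasiMeasurePreserving.ae hx] with t h1 h2 h3 h4
      rw [Pi.sub_apply, Pi.add_apply, h2, Pi.smul_apply, h1, h3, h4]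
      have e1 : s⁻¹ * t ∈ s⁻¹ • E ↔ t ∈ E := by
        simp [mem_smul_set_iff_inv_smul_mem]
      have e2 : t ∈ s • E ↔ s⁻¹ * t ∈ E := by
        simp [mem_smul_set_iff_inv_smul_mem]
      have hvt : t ∉ K → v t = 0 := hvK t
      have hcv : c * (c⁻¹ * v t) = v t := mul_inv_cancel_left₀ hc _
      -- Membership in `K` matters only in the two cases with `t ∉ E`.
      by_cases hst : s⁻¹ * t ∈ E <;> by_cases htE : t ∈ E
      on_goal 2 => by_cases htK : t ∈ K
      on_goal 5 => by_cases htK : t ∈ K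
      all_goals
        simp only [htE, hst, iff_true, iff_false] at e1 e2
        simp [indicator, *, mul_add, sub_eq_neg_add]
    rw [Lp.edist_def, eLpNorm_congr_ae heq]
    exact (eLpNorm_add_le (hmeas' v hv) (hmeas _ _ _ hu) hp1).trans
      (add_le_add (hrest v hvC) (hbound s c u huC))

end Approximation

/-! ### Transitivity of the scaled translations. -/

section Transitivity

variable {G : Type*} [Group G] [TopologicalSpace G] [IsTopologicalGroup G]
  [T2Space G] [LocallyCompactSpace G] [SecondCountableTopology G]
  [MeasurableSpace G] [BorelSpace G] {μ : Measure G} {p : ℝ≥0∞} {ω : G → ℝ}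

/-- A weighted space has a dense vector as soon as its weight can be made small in both directions
on most of any compact set: the scaled translations form a topologically transitive family. -/
theorem exists_isDenseVector_of_essSupOn_small [μ.IsHaarMeasure] [Fact (1 ≤ p)] {S : Set G}
    {Γ : Set ℂ} (hp' : p ≠ ∞) (hpos : ∀ t, 0 < ω t)
    (hint : LocallyIntegrable (fun t => ω t ^ p.toReal) μ)
    (hS : ∀ s ∈ S, translationBound μ ω s < ∞)
    (h : ∀ K : Set G, IsCompact K → ∀ ε δ : ℝ, 0 < ε → 0 < δ →
      ∃ s ∈ S, ∃ c ∈ Γ \ {0}, ∃ E ⊆ K, IsCompact E ∧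
        μ (K \ E) < ENNReal.ofReal δ ∧
        ENNReal.ofReal ‖c‖ * essSupOn μ ω (s • E) < ENNReal.ofReal ε ∧
        ENNReal.ofReal ‖c‖⁻¹ * essSupOn μ ω (s⁻¹ • E) < ENNReal.ofReal ε) :
    ∃ f : WeightedLp μ p ω, IsDenseVector Γ S f := by
  have hp1 : 1 ≤ p := Fact.out
  have hp0 : p ≠ 0 := (zero_lt_one.trans_le hp1).ne'
  have hr : 0 < p.toReal := ENNReal.toReal_pos hp0 hp'
  have hω : AEMeasurable ω μ := aemeasurable_of_locallyIntegrable_rpow hp0 hp' hpos hint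
  have hae : ae (weightedMeasure μ p ω) = ae μ := ae_weightedMeasure hω hpos
  have : IsLocallyFiniteMeasure (weightedMeasure μ p ω) :=
    isLocallyFiniteMeasure_weightedMeasure hpos hint
  -- Finiteness of `p` makes the weighted space second countable, as the category argument needs.
  have : Fact (p ≠ ∞) := ⟨hp'⟩
  choose T hT using fun s : S => exists_translation_continuousLinearMap (p := p) hω hpos (hS s s.2)
  obtain ⟨x, hx⟩ := exists_dense_range_of_transitive
    (fun (i : S × (Γ \ {0} : Set ℂ)) (f : WeightedLp μ p ω) => (i.2 : ℂ) • T i.1 f)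
    (fun i => ((i.2 : ℂ) • T i.1).continuous) fun U V hU hV hUne hVne => by
      obtain ⟨f, hfU, u, hu, hus, hfu⟩ :=
        (dense_hasCompactSupport_Lp hp').inter_open_nonempty U hU hUne
      obtain ⟨g, hgV, v, hv, hvs, hgv⟩ :=
        (dense_hasCompactSupport_Lp hp').inter_open_nonempty V hV hVne
      obtain ⟨r₁, hr₁, hfr⟩ := EMetric.isOpen_iff.1 hU f hfU
      obtain ⟨r₂, hr₂, hgr⟩ := EMetric.isOpen_iff.1 hV g hgV
      obtain ⟨C₁, hC₁⟩ := hu.bounded_above_of_compact_support hus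
      obtain ⟨C₂, hC₂⟩ := hv.bounded_above_of_compact_support hvs
      set C := max C₁ C₂
      set K := tsupport u ∪ tsupport v
      have hK : IsCompact K := hus.isCompact.union hvs.isCompact
      set ρ := min r₁ r₂ with hρ
      have hρ0 : 0 < ρ := lt_min hr₁ hr₂
      set B := μ K ^ (1 / p.toReal)
      have hB : B ≠ ∞ := ENNReal.rpow_ne_top_of_nonneg (by positivity) hK.measure_ne_top
      -- Each of the two error terms is allotted `ρ / 2`: `ε` handles the translated term, `η` the
      -- remainder on `K \ E`.
      obtain ⟨ε, hε, hεle⟩ : ∃ ε : ℝ, 0 < ε ∧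
          ENNReal.ofReal C * (ENNReal.ofReal ε * B) < ρ / 2 := by
        obtain ⟨n, hn, hlt⟩ := ENNReal.exists_nnreal_pos_mul_lt
          (ENNReal.mul_ne_top ENNReal.ofReal_ne_top hB) (ENNReal.half_pos hρ0.ne').ne'
        exact ⟨n, hn, by rwa [ENNReal.ofReal_coe_nnreal, mul_left_comm]⟩
      obtain ⟨η, hη, hηle⟩ : ∃ η : ℝ≥0∞, 0 < η ∧
          ENNReal.ofReal C * η ^ (1 / p.toReal) < ρ / 2 := by
        obtain ⟨n, hn, hlt⟩ := ENNReal.exists_nnreal_pos_mul_lt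
          (ENNReal.ofReal_ne_top (r := C)) (ENNReal.half_pos hρ0.ne').ne'
        refine ⟨(n : ℝ≥0∞) ^ p.toReal,
          ENNReal.rpow_pos (ENNReal.coe_pos.2 hn) ENNReal.coe_ne_top, ?_⟩
        rwa [← ENNReal.rpow_mul, mul_one_div_cancel hr.ne', ENNReal.rpow_one, mul_comm]
      obtain ⟨δ, hδ, hδη⟩ := exists_weightedMeasure_lt_of_measure_lt (p := p) (ω := ω) (μ := μ)
        hK.measurableSet hK.measure_ne_top hη.ne'
      obtain ⟨s, hs, c, hc, E, hEK, hE, hμE, h1, h2⟩ := h K hK ε δ hε hδ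
      have hsmall := hδη (K \ E) sdiff_subset (hK.measurableSet.diff hE.measurableSet) hμE
      have hE2 : essSupOn μ ω (s⁻¹ • E) ≠ ∞ := fun htop => by
        rw [htop, ENNReal.mul_top
          (ENNReal.ofReal_pos.2 (inv_pos.2 (norm_pos_iff.2 hc.2))).ne'] at h2
        exact not_top_lt h2
      obtain ⟨x, hx1, hx2⟩ := exists_Lp_approx_of_essSupOn_small hp' hω hpos hK.measurableSet
        hE.measurableSet hu hv (hae ▸ hfu) (hae ▸ hgv)
        (fun t ht => image_eq_zero_of_notMem_tsupport fun h => ht (.inl h))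
        (fun t ht => image_eq_zero_of_notMem_tsupport fun h => ht (.inr h))
        (fun t => (hC₁ t).trans (le_max_left C₁ C₂)) (fun t => (hC₂ t).trans (le_max_right C₁ C₂))
        hc.2 (hT ⟨s, hs⟩) hE2 hEK hK.measure_ne_top
      refine ⟨(⟨s, hs⟩, ⟨c, hc⟩), x, hfr ?_, hgr ?_⟩
      · refine (hx1.trans_lt ?_).trans_le (min_le_left r₁ r₂)
        rw [← ENNReal.add_halves (min r₁ r₂)]
        refine ENNReal.add_lt_add (lt_of_le_of_lt ?_ hηle) (lt_of_le_of_lt ?_ hεle) <;> gcongr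
      · refine (hx2.trans_lt ?_).trans_le (min_le_right r₁ r₂)
        rw [← ENNReal.add_halves (min r₁ r₂)]
        refine ENNReal.add_lt_add (lt_of_le_of_lt ?_ hηle) (lt_of_le_of_lt ?_ hεle) <;> gcongr
  -- The orbit under nonzero scalars is already dense, and the full orbit contains it.
  refine ⟨x, hx.mono ?_⟩
  rintro _ ⟨⟨s, c⟩, rfl⟩
  refine ⟨c, c.2.1, s, s.2, ?_⟩
  filter_upwards [hT s x, hae ▸ Lp.coeFn_smul (c : ℂ) (T s x)] with t h1 h2
  simp [h2, h1]

end Transitivity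

theorem theorem18 {G : Type*} [Group G] [TopologicalSpace G] [IsTopologicalGroup G]
    [T2Space G] [LocallyCompactSpace G] [SecondCountableTopology G] [NoncompactSpace G]
    [MeasurableSpace G] [BorelSpace G] (μ : Measure G) [μ.IsHaarMeasure]
    (S : Set G) (p : ℝ≥0∞) [Fact (1 ≤ p)] (ω : G → ℝ) (Γ : Set ℂ)
    (hadm : IsAdmissibleTuple μ S p ω Γ) :
    ((∀ K : Set G, IsCompact K → ∀ ε δ : ℝ, 0 < ε → 0 < δ →
        ∃ s ∈ S, ∃ c ∈ Γ \ {0}, ∃ E ⊆ K, IsCompact E ∧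
          μ (K \ E) < ENNReal.ofReal δ ∧
          ENNReal.ofReal ‖c‖ * essSupOn μ ω (s • E) < ENNReal.ofReal ε ∧
          ENNReal.ofReal ‖c‖⁻¹ * essSupOn μ ω (s⁻¹ • E) < ENNReal.ofReal ε) →
      ∃ f : WeightedLp μ p ω, IsDenseVector Γ S f) ∧
    ((∀ K : Set G, IsCompact K → ∃ c ∈ Γ \ {0},
        (⨅ s ∈ S, max (ENNReal.ofReal ‖c‖ * essSupOn μ ω (s • K))
          (ENNReal.ofReal ‖c‖⁻¹ * essSupOn μ ω (s⁻¹ • K))) = 0) →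
      ∃ f : WeightedLp μ p ω, IsDenseVector Γ S f) := by
  have key := exists_isDenseVector_of_essSupOn_small (S := S) (Γ := Γ) hadm.exponent_ne_top
    hadm.weight_pos hadm.weight_locallyIntegrable hadm.translationBound_lt_top
  refine ⟨key, fun h => key fun K hK ε δ hε hδ => ?_⟩
  obtain ⟨c, hc, hinf⟩ := h K hK
  have hlt := hinf.trans_lt (ENNReal.ofReal_pos.2 hε)
  simp only [iInf_lt_iff, max_lt_iff] at hlt
  obtain ⟨s, hs, h1, h2⟩ := hlt
  exact ⟨s, hs, c, hc, K, subset_rfl, hK, by simpa using hδ, h1, h2⟩
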